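/- Notation. Let $\mathbb{S}^d$ be the space of real symmetric $d\times d$ matrices, and let $\mathbb{S}^d_+$ and $\mathbb{S}^d_{++}$ be its subsets of positive semidefinite and positive definite matrices. For a convex cone $C$ in a Euclidean space that is closed and pointed ($C\cap -C=\{0\}$) and for $x\in C$, let $\mathcal{K}_C(x)=\operatorname{cone}\{z-x : z\in C\}$ be the cone of feasible directions and let $\mathcal{L}_C(x)=\overline{\mathcal{K}_C(x)}\cap-\overline{\mathcal{K}_C(x)}$ be the convex tangent space. The cone $C$ is $k$-Terracini convex if $\mathcal{L}_C\big(\sum_{i=1}^k x^{(i)}\big)=\sum_{i=1}^k\mathcal{L}_C(x^{(i)})$ for all (not necessarily distinct) generators $x^{(1)},\dots,x^{(k)}$ of extreme rays of $C$. Let $k$ be a positive integer. A linear map $\mathcal{A}:\mathbb{S}^d\to\mathbb{R}^n$ has the exact recovery property if for every $X^\star\in\mathbb{S}^d_+$ with $\operatorname{rank}(X^\star)\le k$, the matrix $X^\star$ is the unique optimal solution of $$\min_{X\in\mathbb{S}^d}\ \operatorname{tr}(X)\quad\text{s.t.}\quad \mathcal{A}(X)=\mathcal{A}(X^\star),\ X\succeq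 0 .$$ For a linear map $\mathcal{B}:\mathbb{S}^d\to\mathbb{R}^N$, the cone $\mathcal{B}(\mathbb{S}^d_+)$ has the Terracini convexity property if it is closed and pointed, its extreme rays are in one-to-one correspondence with those of $\mathbb{S}^d_+$ (that is, $R\mapsto\mathcal{B}(R)$ is a bijection from the extreme rays of $\mathbb{S}^d_+$ to those of $\mathcal{B}(\mathbb{S}^d_+)$), and it is $k$-Terracini convex. Theorem. Let $\mathcal{A}:\mathbb{S}^d\to\mathbb{R}^n$ be a linear map and let $k<d$ be a positive integer. For a linear map $\tilde{\mathcal{A}}:\mathbb{S}^d\to\mathbb{R}^n$ define $\tilde{\mathcal{B}}:\mathbb{S}^d\to\mathbb{R}^{n+1}$ by $\tilde{\mathcal{B}}(X)=(\tilde{\mathcal{A}}(X),\operatorname{tr}(X))$, and let $\mathcal{B}$ be the map so obtained from $\mathcal{A}$. 1. Suppose that $\mathcal{A}$ is surjective and $\operatorname{null}(\mathcal{A})\cap\mathbb{S}^d_{++}\ne\emptyset$. If $\mathcal{A}$ has the exact recovery property, then the cone $\mathcal{B}(\mathbb{S}^d_+)$ has the Terracini convexity property. 2. Suppose that $n>\binom{d+1}{2}-\binom{d-k+1}{2}$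 and that there is an open set $\mathfrak{S}$ in the space of linear maps from $\mathbb{S}^d$ to $\mathbb{R}^n$ such that $\mathcal{A}\in\mathfrak{S}$ and, for each $\tilde{\mathcal{A}}\in\mathfrak{S}$, the map $\tilde{\mathcal{A}}$ is surjective, $\operatorname{null}(\tilde{\mathcal{A}})\cap\mathbb{S}^d_{++}\ne\emptyset$, and the cone $\tilde{\mathcal{B}}(\mathbb{S}^d_+)$ has the Terracini convexity property. Then $\mathcal{A}$ has the exact recovery property. -/

import Mathlib

namespace TerraciniPSD

section Cones

variable {E : Type*} [AddCommGroup E] [Module ℝ E]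

/-- `x` generates an extreme ray of the convex cone `C`: `x ≠ 0` and the half-line `{c • x | 0 ≤ c}`
is a face of `C`. -/
def GeneratesExtremeRay (C : PointedCone ℝ E) (x : E) : Prop :=
  x ≠ 0 ∧ (PointedCone.hull ℝ {x}).IsFaceOf C

/-- The set of extreme rays of the convex cone `C`, each ray being the half-line
`{c • x | 0 ≤ c}` spanned by a generator `x`. -/
def extremeRays (C : PointedCone ℝ E) : Set (PointedCone ℝ E) :=
  {R | ∃ x, GeneratesExtremeRay C x ∧ R = PointedCone.hull ℝ {x}}

/-- The cone of feasible directions from `x` into `C`: the conic hull of `{z - x | z ∈ C}`. -/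
noncomputable def feasibleDirections (C : PointedCone ℝ E) (x : E) : PointedCone ℝ E :=
  PointedCone.hull ℝ {v | ∃ z ∈ C, v = z - x}

variable [TopologicalSpace E] [IsTopologicalAddGroup E] [ContinuousSMul ℝ E]

/-- The tangent cone of `C` at `x`: the closure of the cone of feasible directions. -/
noncomputable def tangentCone (C : PointedCone ℝ E) (x : E) : PointedCone ℝ E :=
  (feasibleDirections C x).closure

/-- The convex tangent space of `C` at `x`: the lineality space `T ∩ -T` of the tangent cone `T`
of `C` at `x`. -/
noncomputable def convexTangentSpace (C : PointedCone ℝ E) (x : E) : Submodule ℝ E :=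
  (tangentCone C x).lineal

/-- A convex cone `C` is `k`-Terracini convex if it is closed, it is pointed (`C ∩ -C = {0}`, which
is `Salient` in Mathlib), and for all generators `x₁, …, xₖ` of extreme rays of `C` (repetitions
allowed) the convex tangent space at `x₁ + ⋯ + xₖ` is the sum of those at the `xᵢ`. -/
def IsTerraciniConvex (k : ℕ) (C : PointedCone ℝ E) : Prop :=
  IsClosed (C : Set E) ∧ (C : ConvexCone ℝ E).Salient ∧
    ∀ x : Fin k → E, (∀ i, GeneratesExtremeRay C (x i)) →
      convexTangentSpace C (∑ i, x i) = ⨆ i, convexTangentSpace C (x i)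

end Cones

/-- The space of real symmetric `d × d` matrices. -/
abbrev SymMat (d : ℕ) : Submodule ℝ (Matrix (Fin d) (Fin d) ℝ) where
  carrier := {M | M.IsSymm}
  add_mem' := fun ha hb => Matrix.IsSymm.add ha hb
  zero_mem' := Matrix.isSymm_zero
  smul_mem' := fun c _ h => Matrix.IsSymm.smul h c

/-- The cone of positive semidefinite matrices in the space of symmetric matrices. -/
noncomputable def psdCone (d : ℕ) : PointedCone ℝ (SymMat d) where
  carrier := {X | (X : Matrix (Fin d) (Fin d) ℝ).PosSemidef}
  add_mem' := fun ha hb => Matrix.PosSemidef.add ha hb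
  zero_mem' := Matrix.PosSemidef.zero
  smul_mem' := fun c _ h => Matrix.PosSemidef.smul h c.2

/-- The trace of a symmetric matrix. -/
noncomputable def tr {d : ℕ} (X : SymMat d) : ℝ := Matrix.trace (X : Matrix (Fin d) (Fin d) ℝ)

/-- The linear map `X ↦ (A X, tr X)` from symmetric matrices to `ℝⁿ⁺¹`; the trace is the last
coordinate. -/
noncomputable def withTrace {d n : ℕ} (A : SymMat d →ₗ[ℝ] (Fin n → ℝ)) : SymMat d →ₗ[ℝ] (Fin (n + 1) → ℝ) where
  toFun X := Fin.snoc (α := fun _ => ℝ) (A X) (tr X)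
  map_add' X Y := by
    funext i
    refine Fin.lastCases ?_ (fun j => ?_) i <;> simp [tr, Matrix.trace_add]
  map_smul' c X := by
    funext i
    refine Fin.lastCases ?_ (fun j => ?_) i <;> simp [tr, Matrix.trace_smul]

/-- The set of optimal solutions of the semidefinite program of minimizing `tr X` subject to
`A X = b` and `X ⪰ 0`. -/
def traceMinimizers {d n : ℕ} (A : SymMat d →ₗ[ℝ] (Fin n → ℝ)) (b : Fin n → ℝ) :
    Set (SymMat d) :=
  {X | X ∈ psdCone d ∧ A X = b ∧ ∀ Y ∈ psdCone d, A Y = b → tr X ≤ tr Y}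

/-- The exact recovery property: every positive semidefinite `X` of rank at most `k` is the unique
optimal solution of the trace minimization program with right-hand side `A X`. -/
def ExactRecovery {d n : ℕ} (k : ℕ) (A : SymMat d →ₗ[ℝ] (Fin n → ℝ)) : Prop :=
  ∀ X ∈ psdCone d, (X : Matrix (Fin d) (Fin d) ℝ).rank ≤ k → traceMinimizers A (A X) = {X}

/-- The Terracini convexity property of the image of the positive semidefinite cone under `B`: the
image is closed and pointed, `R ↦ B(R)` is a one-to-one correspondence from the extreme rays of the
positive semidefinite cone to those of the image, and the image is `k`-Terracini convex. -/
def TerraciniProperty {d N : ℕ} (k : ℕ) (B : SymMat d →ₗ[ℝ] (Fin N → ℝ)) : Prop :=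
  IsClosed ((psdCone d).map B : Set (Fin N → ℝ)) ∧
    ((psdCone d).map B : ConvexCone ℝ (Fin N → ℝ)).Salient ∧
    Set.BijOn (PointedCone.map B) (extremeRays (psdCone d)) (extremeRays ((psdCone d).map B)) ∧
    IsTerraciniConvex k ((psdCone d).map B)

/-- `A` is onto and its kernel contains a positive definite matrix. -/
def IsSurjectiveWithPosDefKernel {d n : ℕ} (A : SymMat d →ₗ[ℝ] (Fin n → ℝ)) : Prop :=
  Function.Surjective A ∧ ∃ X : SymMat d, (X : Matrix (Fin d) (Fin d) ℝ).PosDef ∧ A X = 0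

/-- A set of linear maps is open for the usual topology of the finite-dimensional space of linear
maps. All linear maps in question are continuous, and the topology is the one Mathlib puts on
spaces of continuous linear maps (that of the operator norm). -/
def IsOpenSetOfMaps {d n : ℕ} (S : Set (SymMat d →ₗ[ℝ] (Fin n → ℝ))) : Prop :=
  IsOpen ((LinearMap.toContinuousLinearMap :
    (SymMat d →ₗ[ℝ] (Fin n → ℝ)) ≃ₗ[ℝ] (SymMat d →L[ℝ] (Fin n → ℝ))) '' S)

end TerraciniPSD

/-! Both properties are compared with a condition on the kernel of B. For vectors x₁, …, x_k, the
cone `semidefOn x` contains the tangent cone of the PSD cone at Σ xᵢxᵢᵀ, and each of its elements is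
U − MᵀM with U ⪰ 0 and M having k rows (`exists_sub_of_mem_semidefOn`).

Part 1: if such a U − MᵀM lies in ker B, then U is feasible for X⋆ = MᵀM with the same trace, so
recovery forces U = MᵀM (`kernel_of_exactRecovery`). A kernel meeting every `semidefOn x` only in 0
makes the image cones closed, and extreme rays and tangent spaces are carried over from the PSD cone
(`terraciniProperty_of_kernel`). There the tangent space at Σ xᵢxᵢᵀ is the sum of those at the
xᵢxᵢᵀ, because a symmetric Z whose form vanishes on the complement of the xᵢ is Σ (xᵢyᵢᵀ + yᵢxᵢᵀ)
(`lineal_semidefOn_le`).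

Part 2: if recovery fails, some X of rank at most k and some PSD Y ≠ X have the same image under B.
A small change of A makes a sum of k nonzero rank-one matrices and a positive definite matrix share
an image (`exists_perturbation`). At that point the tangent space is all of ℝⁿ⁺¹, since a positive
definite matrix is interior and B is onto. Terracini convexity bounds its dimension by C(d+1,2) −
C(d−k+1,2) < n (`finrank_convexTangentSpace_le`), a contradiction. -/

namespace TerraciniPSD

/-! ### Rays, feasible directions and tangent spaces under addition and linear maps. -/

section GeneralCones

variable {E F : Type*} [AddCommGroup E] [Module ℝ E] [AddCommGroup F] [Module ℝ F]

lemma mem_hull_singleton {x y : E} :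
    y ∈ PointedCone.hull ℝ {x} ↔ ∃ c : ℝ, 0 ≤ c ∧ c • x = y := by
  refine Submodule.mem_span_singleton.trans ⟨?_, ?_⟩
  · rintro ⟨a, rfl⟩
    exact ⟨a, a.2, rfl⟩
  · rintro ⟨c, hc, rfl⟩
    exact ⟨⟨c, hc⟩, rfl⟩

lemma self_mem_hull (x : E) : x ∈ PointedCone.hull ℝ {x} :=
  PointedCone.subset_hull rfl

lemma hull_singleton_smul (x : E) {c : ℝ} (hc : 0 < c) :
    PointedCone.hull ℝ {c • x} = PointedCone.hull ℝ {x} := by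
  ext y
  simp only [mem_hull_singleton]
  constructor
  · rintro ⟨a, ha, rfl⟩
    exact ⟨a * c, by positivity, by rw [mul_smul]⟩
  · rintro ⟨a, ha, rfl⟩
    exact ⟨a / c, by positivity, by rw [smul_smul, div_mul_cancel₀ _ hc.ne']⟩

lemma hull_singleton_eq_of_mem {x y : E} (hy : y ≠ 0) (h : y ∈ PointedCone.hull ℝ {x}) :
    PointedCone.hull ℝ {y} = PointedCone.hull ℝ {x} := by
  obtain ⟨c, hc, rfl⟩ := mem_hull_singleton.1 h
  refine hull_singleton_smul x (lt_of_le_of_ne hc ?_)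
  rintro rfl
  simp at hy

lemma map_hull_singleton (B : E →ₗ[ℝ] F) (x : E) :
    (PointedCone.hull ℝ {x}).map B = PointedCone.hull ℝ {B x} := by
  ext y
  simp only [PointedCone.mem_map, mem_hull_singleton]
  constructor
  · rintro ⟨_, ⟨c, hc, rfl⟩, rfl⟩
    exact ⟨c, hc, by simp⟩
  · rintro ⟨c, hc, rfl⟩
    exact ⟨_, ⟨c, hc, rfl⟩, by simp⟩

lemma generatesExtremeRay_iff {C : PointedCone ℝ E} {x : E} :
    GeneratesExtremeRay C x ↔ PointedCone.hull ℝ {x} ∈ extremeRays C := by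
  refine ⟨fun h => ⟨x, h, rfl⟩, ?_⟩
  rintro ⟨y, ⟨hy, hf⟩, he⟩
  refine ⟨?_, he ▸ hf⟩
  rintro rfl
  have := self_mem_hull y
  rw [← he, mem_hull_singleton] at this
  obtain ⟨c, -, rfl⟩ := this
  simp at hy

/-- Each direction z − x equals (z + y) − (x + y). -/
lemma feasibleDirections_le_add {C : PointedCone ℝ E} (x : E) {y : E} (hy : y ∈ C) :
    feasibleDirections C x ≤ feasibleDirections C (x + y) := by
  refine Submodule.span_mono ?_
  rintro _ ⟨z, hz, rfl⟩
  exact ⟨z + y, C.add_mem hz hy, by abel⟩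

lemma map_feasibleDirections (C : PointedCone ℝ E) (B : E →ₗ[ℝ] F) (x : E) :
    (feasibleDirections C x).map B = feasibleDirections (C.map B) (B x) := by
  unfold feasibleDirections PointedCone.map PointedCone.hull
  rw [Submodule.map_span]
  congr 1
  ext v
  constructor
  · rintro ⟨_, ⟨z, hz, rfl⟩, rfl⟩
    exact ⟨B z, ⟨z, hz, rfl⟩, by simp⟩
  · rintro ⟨_, ⟨z, hz, rfl⟩, rfl⟩
    exact ⟨z - x, ⟨z, hz, rfl⟩, by simp⟩

variable [TopologicalSpace E] [IsTopologicalAddGroup E] [ContinuousSMul ℝ E]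
variable [TopologicalSpace F] [IsTopologicalAddGroup F] [ContinuousSMul ℝ F]

lemma convexTangentSpace_le_add {C : PointedCone ℝ E} (x : E) {y : E} (hy : y ∈ C) :
    convexTangentSpace C x ≤ convexTangentSpace C (x + y) := by
  have h : tangentCone C x ≤ tangentCone C (x + y) :=
    closure_mono (feasibleDirections_le_add x hy)
  exact fun v hv => ⟨h hv.1, h hv.2⟩

lemma iSup_convexTangentSpace_le_sum {ι : Type*} [Fintype ι] {C : PointedCone ℝ E} {x : ι → E}
    (hx : ∀ i, x i ∈ C) :
    ⨆ i, convexTangentSpace C (x i) ≤ convexTangentSpace C (∑ i, x i) := by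
  classical
  refine iSup_le fun i => ?_
  rw [← Finset.add_sum_erase _ _ (Finset.mem_univ i)]
  exact convexTangentSpace_le_add _ (C.sum_mem fun j _ => hx j)

lemma map_convexTangentSpace_le (C : PointedCone ℝ E) {B : E →ₗ[ℝ] F} (hB : Continuous B)
    (x : E) : (convexTangentSpace C x).map B ≤ convexTangentSpace (C.map B) (B x) := by
  have h : ∀ v ∈ tangentCone C x, B v ∈ tangentCone (C.map B) (B x) := by
    intro v hv
    have := image_closure_subset_closure_image hB (Set.mem_image_of_mem B hv)
    rw [← PointedCone.coe_map, map_feasibleDirections] at this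
    exact this
  rintro _ ⟨v, hv, rfl⟩
  exact ⟨h v hv.1, by simpa using h _ hv.2⟩

end GeneralCones

/-! ### Tangent spaces of image cones, bounded from above. -/

section TangentImage

variable {E F : Type*} [AddCommGroup E] [Module ℝ E] [AddCommGroup F] [Module ℝ F]
variable [TopologicalSpace F] [IsTopologicalAddGroup F] [ContinuousSMul ℝ F]

/-- If the tangent cone is bounded above by a closed cone `T` that meets `ker B` trivially and has a
closed image, then the convex tangent space of the image cone comes from the lineality space of
`T`. -/
lemma convexTangentSpace_map_le {C T : PointedCone ℝ E} {B : E →ₗ[ℝ] F} {x : E}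
    (hT : feasibleDirections C x ≤ T) (hker : ∀ z ∈ T, B z = 0 → z = 0)
    (hcl : IsClosed (T.map B : Set F)) :
    convexTangentSpace (C.map B) (B x) ≤ T.lineal.map B := by
  have h : tangentCone (C.map B) (B x) ≤ T.map B := by
    refine closure_minimal ?_ hcl
    rw [← map_feasibleDirections]
    exact Submodule.map_mono hT
  rintro v ⟨h1, h2⟩
  obtain ⟨a, ha, rfl⟩ := h h1
  obtain ⟨b, hb, hab⟩ := h h2
  -- The sum a + b lies in `T` and in the kernel of `B`, so it is 0.
  have hb' : b = -a := by
    refine eq_neg_of_add_eq_zero_right (hker _ (T.add_mem ha hb) ?_)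
    rw [map_add]
    exact (congrArg (B a + ·) hab).trans (add_neg_cancel _)
  subst hb'
  exact ⟨a, ⟨ha, hb⟩, rfl⟩

end TangentImage

/-! ### Closedness of linear images of closed cones. -/

section ClosedImage

/-- The constant is the minimum of ‖B z‖ over the compact set of unit vectors of `T`, positive by
the kernel condition; homogeneity does the rest. -/
lemma exists_pos_mul_norm_le_norm_map {E F : Type*} [NormedAddCommGroup E] [NormedSpace ℝ E]
    [FiniteDimensional ℝ E] [NormedAddCommGroup F] [NormedSpace ℝ F] {T : PointedCone ℝ E}
    (hT : IsClosed (T : Set E)) {B : E →ₗ[ℝ] F} (hker : ∀ z ∈ T, B z = 0 → z = 0) :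
    ∃ c > 0, ∀ z ∈ T, c * ‖z‖ ≤ ‖B z‖ := by
  have hBc : Continuous B := B.continuous_of_finiteDimensional
  have hcomp : IsCompact (Metric.sphere (0 : E) 1 ∩ T) := (isCompact_sphere 0 1).inter_right hT
  obtain ⟨c, hc, hcB⟩ : ∃ c > 0, ∀ z ∈ Metric.sphere (0 : E) 1 ∩ T, c ≤ ‖B z‖ := by
    rcases (Metric.sphere (0 : E) 1 ∩ T).eq_empty_or_nonempty with h | h
    · exact ⟨1, one_pos, by simp [h]⟩
    · obtain ⟨w, hw, hmin⟩ := hcomp.exists_isMinOn h hBc.norm.continuousOn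
      refine ⟨‖B w‖, norm_pos_iff.2 fun h0 => ?_, fun z hz => hmin hz⟩
      have := hker w hw.2 h0
      simp [this] at hw
  refine ⟨c, hc, fun z hz => ?_⟩
  rcases eq_or_ne z 0 with rfl | hz0
  · simp
  have hpos : 0 < ‖z‖ := norm_pos_iff.2 hz0
  have := hcB (‖z‖⁻¹ • z) ⟨by simp [norm_smul, hpos.ne'], T.smul_mem (by positivity) hz⟩
  rw [map_smul, norm_smul, norm_inv, norm_norm, inv_mul_eq_div, le_div_iff₀ hpos] at this
  exact this

/-- By the lower bound on ‖B z‖, image points near y come from a compact part of `T`. -/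
lemma isClosed_map_of_normed {E F : Type*} [NormedAddCommGroup E] [NormedSpace ℝ E]
    [FiniteDimensional ℝ E] [NormedAddCommGroup F] [NormedSpace ℝ F] {T : PointedCone ℝ E}
    (hT : IsClosed (T : Set E)) {B : E →ₗ[ℝ] F} (hker : ∀ z ∈ T, B z = 0 → z = 0) :
    IsClosed (T.map B : Set F) := by
  obtain ⟨c, hc, hbound⟩ := exists_pos_mul_norm_le_norm_map hT hker
  have hBc : Continuous B := B.continuous_of_finiteDimensional
  refine isClosed_of_closure_subset fun y hy => ?_
  have hK : IsCompact (Metric.closedBall (0 : E) ((‖y‖ + 1) / c) ∩ T) :=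
    (isCompact_closedBall _ _).inter_right hT
  have hsub : Metric.ball y 1 ∩ (T.map B : Set F) ⊆
      B '' (Metric.closedBall (0 : E) ((‖y‖ + 1) / c) ∩ T) := by
    rintro _ ⟨h1, z, hz, rfl⟩
    refine ⟨z, ⟨?_, hz⟩, rfl⟩
    rw [mem_closedBall_zero_iff, le_div_iff₀ hc, mul_comm]
    refine (hbound z hz).trans ?_
    have h2 : ‖B z - y‖ < 1 := by simpa [dist_eq_norm] using h1
    have h3 := norm_add_le (B z - y) y
    rw [sub_add_cancel] at h3
    linarith
  have hmem := Metric.isOpen_ball.inter_closure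
    (⟨Metric.mem_ball_self one_pos, hy⟩ : y ∈ Metric.ball y 1 ∩ closure (T.map B : Set F))
  obtain ⟨z, hz, rfl⟩ := closure_minimal hsub (hK.image hBc).isClosed hmem
  exact ⟨z, hz.2, rfl⟩

/-- The image of a closed cone under a linear map whose kernel meets the cone trivially is
closed. -/
lemma isClosed_map_of_ker {E F : Type*} [AddCommGroup E] [Module ℝ E] [TopologicalSpace E]
    [IsTopologicalAddGroup E] [ContinuousSMul ℝ E] [T2Space E]
    [FiniteDimensional ℝ E] [NormedAddCommGroup F] [NormedSpace ℝ F] {T : PointedCone ℝ E}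
    (hT : IsClosed (T : Set E)) {B : E →ₗ[ℝ] F} (hker : ∀ z ∈ T, B z = 0 → z = 0) :
    IsClosed (T.map B : Set F) := by
  -- A linear homeomorphism with a Euclidean space supplies the norm on the source.
  let e := toEuclidean (E := E)
  let e' : E →ₗ[ℝ] EuclideanSpace ℝ (Fin (Module.finrank ℝ E)) := e.toLinearEquiv.toLinearMap
  let f' : EuclideanSpace ℝ (Fin (Module.finrank ℝ E)) →ₗ[ℝ] E := e.symm.toLinearEquiv.toLinearMap
  have hcl : IsClosed (T.map e' : Set (EuclideanSpace ℝ (Fin (Module.finrank ℝ E)))) :=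
    e.toHomeomorph.isClosedMap _ hT
  have hfe : ∀ z, f' (e' z) = z := e.symm_apply_apply
  have := isClosed_map_of_normed hcl (B := B.comp f') (by
    rintro _ ⟨z, hz, rfl⟩ h0
    rw [LinearMap.comp_apply] at h0
    have : B z = 0 := (congrArg B (hfe z)).symm.trans h0
    rw [hker z hz this]
    simp)
  rw [PointedCone.map_map] at this
  have h2 : (B.comp f').comp e' = B := by
    ext z
    exact congrArg B (hfe z)
  rwa [h2] at this

end ClosedImage

open Matrix

/-! ### The PSD cone, its tangent cones and their lineality spaces. -/

section Semidefinite

variable {d k : ℕ}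

lemma mem_psdCone_iff {X : SymMat d} :
    X ∈ psdCone d ↔ ∀ u : Fin d → ℝ, 0 ≤ u ⬝ᵥ (X.1 *ᵥ u) := by
  refine ⟨fun h u => by simpa using Matrix.PosSemidef.dotProduct_mulVec_nonneg h u, fun h => ?_⟩
  refine Matrix.PosSemidef.of_dotProduct_mulVec_nonneg ?_ (by simpa using h)
  rw [Matrix.IsHermitian, conjTranspose_eq_transpose_of_trivial]
  exact X.2

/-- The rank-one symmetric matrix `x xᵀ`. -/
def outer (x : Fin d → ℝ) : SymMat d := ⟨vecMulVec x x, by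
  change _ = _
  rw [transpose_vecMulVec]⟩

/-- The symmetric matrix `x yᵀ + y xᵀ`. -/
def symProd (x y : Fin d → ℝ) : SymMat d := ⟨vecMulVec x y + vecMulVec y x, by
  change _ = _
  rw [transpose_add, transpose_vecMulVec, transpose_vecMulVec, add_comm]⟩

/-- The Gram matrix `Mᵀ M`. -/
def gram (M : Matrix (Fin k) (Fin d) ℝ) : SymMat d := ⟨Mᵀ * M, by
  change _ = _
  rw [transpose_mul, transpose_transpose]⟩

/-- The congruence `Z ↦ Rᵀ Z R`. -/
def congruence {m : ℕ} (R : Matrix (Fin d) (Fin m) ℝ) : SymMat d →ₗ[ℝ] SymMat m where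
  toFun Z := ⟨Rᵀ * Z.1 * R, by
    change _ = _
    have : Z.1ᵀ = Z.1 := Z.2
    rw [transpose_mul, transpose_mul, transpose_transpose, this, Matrix.mul_assoc]⟩
  map_add' Z W := Subtype.ext (by simp [Matrix.mul_add, Matrix.add_mul])
  map_smul' c Z := Subtype.ext (by simp)

lemma dotProduct_congruence {m : ℕ} (R : Matrix (Fin d) (Fin m) ℝ) (Z : SymMat d)
    (u : Fin m → ℝ) :
    u ⬝ᵥ ((congruence R Z).1 *ᵥ u) = (R *ᵥ u) ⬝ᵥ (Z.1 *ᵥ (R *ᵥ u)) := by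
  change u ⬝ᵥ ((Rᵀ * Z.1 * R) *ᵥ u) = _
  rw [← mulVec_mulVec, ← mulVec_mulVec, dotProduct_mulVec, vecMul_transpose]

lemma dotProduct_outer (x u : Fin d → ℝ) : u ⬝ᵥ ((outer x).1 *ᵥ u) = (x ⬝ᵥ u) ^ 2 := by
  change u ⬝ᵥ (vecMulVec x x *ᵥ u) = _
  rw [vecMulVec_mulVec, dotProduct_smul, dotProduct_comm u x]
  simp [pow_two]

lemma outer_mem (x : Fin d → ℝ) : outer x ∈ psdCone d :=
  mem_psdCone_iff.2 fun u => by rw [dotProduct_outer]; positivity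

lemma gram_eq_sum (M : Matrix (Fin k) (Fin d) ℝ) : gram M = ∑ i, outer (M i) := by
  apply Subtype.ext
  ext a b
  rw [AddSubmonoidClass.coe_finsetSum, Matrix.sum_apply]
  simp [gram, outer, Matrix.mul_apply, vecMulVec_apply]

lemma gram_mem (M : Matrix (Fin k) (Fin d) ℝ) : gram M ∈ psdCone d := by
  rw [gram_eq_sum]
  exact (psdCone d).sum_mem fun i _ => outer_mem _

lemma rank_gram_le (M : Matrix (Fin k) (Fin d) ℝ) : (gram M).1.rank ≤ k := by
  change (Mᵀ * M).rank ≤ k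
  refine (rank_mul_le_right _ _).trans ?_
  simpa using rank_le_height M

lemma tr_outer (x : Fin d → ℝ) : tr (outer x) = x ⬝ᵥ x := trace_vecMulVec x x

/-- The trace as a linear functional. -/
noncomputable def trLin (d : ℕ) : SymMat d →ₗ[ℝ] ℝ where
  toFun := tr
  map_add' X Y := by simp [tr, trace_add]
  map_smul' c X := by simp [tr, trace_smul]

lemma trLin_apply (X : SymMat d) : trLin d X = tr X := rfl

lemma tr_add (X Y : SymMat d) : tr (X + Y) = tr X + tr Y := (trLin d).map_add X Y

lemma tr_smul (c : ℝ) (X : SymMat d) : tr (c • X) = c * tr X := (trLin d).map_smul c X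

lemma tr_nonneg {X : SymMat d} (hX : X ∈ psdCone d) : 0 ≤ tr X := PosSemidef.trace_nonneg hX

lemma eq_zero_of_tr_eq_zero {X : SymMat d} (hX : X ∈ psdCone d) (h : tr X = 0) : X = 0 :=
  Subtype.ext ((PosSemidef.trace_eq_zero_iff hX).1 h)

lemma eq_zero_of_form_eq_zero {X : SymMat d} (h : ∀ u : Fin d → ℝ, u ⬝ᵥ (X.1 *ᵥ u) = 0) :
    X = 0 := by
  refine eq_zero_of_tr_eq_zero (mem_psdCone_iff.2 fun u => (h u).ge) ?_
  change ∑ i, X.1 i i = 0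
  exact Finset.sum_eq_zero fun i _ => by simpa using h (Pi.single i 1)

lemma isClosed_psdCone (d : ℕ) : IsClosed (psdCone d : Set (SymMat d)) := by
  have : (psdCone d : Set (SymMat d)) = ⋂ u : Fin d → ℝ, {X | 0 ≤ u ⬝ᵥ (X.1 *ᵥ u)} := by
    ext X
    simp [mem_psdCone_iff]
  rw [this]
  refine isClosed_iInter fun u => isClosed_le continuous_const ?_
  exact continuous_const.dotProduct (continuous_subtype_val.matrix_mulVec continuous_const)

/-- The symmetric matrices whose quadratic form is nonnegative on the orthogonal complement of the
vectors `x i`. -/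
def semidefOn (x : Fin k → Fin d → ℝ) : PointedCone ℝ (SymMat d) where
  carrier := {Z | ∀ u : Fin d → ℝ, (∀ i, x i ⬝ᵥ u = 0) → 0 ≤ u ⬝ᵥ (Z.1 *ᵥ u)}
  add_mem' hZ hW u hu := by
    simpa [add_mulVec] using add_nonneg (hZ u hu) (hW u hu)
  zero_mem' u _ := by simp
  smul_mem' c Z hZ u hu := by
    have : u ⬝ᵥ ((c • Z).1 *ᵥ u) = (c : ℝ) * (u ⬝ᵥ (Z.1 *ᵥ u)) := by
      change u ⬝ᵥ (((c : ℝ) • Z.1) *ᵥ u) = _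
      rw [smul_mulVec, dotProduct_smul, smul_eq_mul]
    change 0 ≤ u ⬝ᵥ ((c • Z).1 *ᵥ u)
    rw [this]
    exact mul_nonneg c.2 (hZ u hu)

lemma isClosed_semidefOn (x : Fin k → Fin d → ℝ) :
    IsClosed (semidefOn x : Set (SymMat d)) := by
  have : (semidefOn x : Set (SymMat d)) =
      ⋂ u : Fin d → ℝ, ⋂ _ : ∀ i, x i ⬝ᵥ u = 0, {Z | 0 ≤ u ⬝ᵥ (Z.1 *ᵥ u)} := by
    ext Z
    simp [semidefOn]
  rw [this]
  refine isClosed_iInter fun u => isClosed_iInter fun _ => isClosed_le continuous_const ?_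
  exact continuous_const.dotProduct (continuous_subtype_val.matrix_mulVec continuous_const)

lemma mem_lineal_semidefOn {x : Fin k → Fin d → ℝ} {Z : SymMat d} :
    Z ∈ (semidefOn x).lineal ↔
      ∀ u : Fin d → ℝ, (∀ i, x i ⬝ᵥ u = 0) → u ⬝ᵥ (Z.1 *ᵥ u) = 0 := by
  refine ⟨fun h u hu => ?_, fun h => ⟨fun u hu => (h u hu).ge, fun u hu => ?_⟩⟩
  · have h1 := h.1 u hu
    have h2 := h.2 u hu
    have h3 : u ⬝ᵥ ((-Z).1 *ᵥ u) = -(u ⬝ᵥ (Z.1 *ᵥ u)) := by simp [neg_mulVec]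
    linarith
  · have h3 : u ⬝ᵥ ((-Z).1 *ᵥ u) = -(u ⬝ᵥ (Z.1 *ᵥ u)) := by simp [neg_mulVec]
    change 0 ≤ u ⬝ᵥ ((-Z).1 *ᵥ u)
    rw [h3, h u hu, neg_zero]

lemma form_sum_outer (x : Fin k → Fin d → ℝ) (u : Fin d → ℝ) :
    u ⬝ᵥ ((∑ i, outer (x i)).1 *ᵥ u) = ∑ i, (x i ⬝ᵥ u) ^ 2 := by
  rw [AddSubmonoidClass.coe_finsetSum, sum_mulVec, dotProduct_sum]
  exact Finset.sum_congr rfl fun i _ => dotProduct_outer _ _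

lemma feasibleDirections_psdCone_le (x : Fin k → Fin d → ℝ) :
    feasibleDirections (psdCone d) (∑ i, outer (x i)) ≤ semidefOn x := by
  refine Submodule.span_le.2 ?_
  rintro _ ⟨Z, hZ, rfl⟩ u hu
  have h1 := mem_psdCone_iff.1 hZ u
  have h2 : u ⬝ᵥ ((Z - ∑ i, outer (x i)).1 *ᵥ u) =
      u ⬝ᵥ (Z.1 *ᵥ u) - u ⬝ᵥ ((∑ i, outer (x i)).1 *ᵥ u) := by
    rw [← dotProduct_sub, ← sub_mulVec]
    rfl
  rw [h2, form_sum_outer]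
  simpa [hu] using h1

lemma _root_.LinearMap.exists_generalized_inverse {K V W : Type*} [Field K] [AddCommGroup V]
    [Module K V] [AddCommGroup W] [Module K W] (f : V →ₗ[K] W) :
    ∃ g : W →ₗ[K] V, f ∘ₗ g ∘ₗ f = f := by
  obtain ⟨s, hs⟩ := f.rangeRestrict.exists_rightInverse_of_surjective f.range_rangeRestrict
  obtain ⟨l, hl⟩ := (LinearMap.range f).subtype.exists_leftInverse_of_injective (by simp)
  refine ⟨s ∘ₗ l, LinearMap.ext fun v => ?_⟩
  have h1 : l (f v) = f.rangeRestrict v := LinearMap.congr_fun hl (f.rangeRestrict v)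
  have h2 : f.rangeRestrict (s (f.rangeRestrict v)) = f.rangeRestrict v :=
    LinearMap.congr_fun hs _
  simpa [h1] using congrArg Subtype.val h2

/-- With G a generalized inverse of X and P = GX, the matrix R = 1 − P maps into ker X, and Z − RᵀZR
= PᵀZ + ZP − PᵀZP. -/
lemma exists_decomposition (X : Matrix (Fin k) (Fin d) ℝ) :
    ∃ R : Matrix (Fin d) (Fin d) ℝ, X * R = 0 ∧ ∀ Z : SymMat d,
      ∃ Y : Matrix (Fin k) (Fin d) ℝ, Z.1 = Rᵀ * Z.1 * R + (Xᵀ * Y + Yᵀ * X) := by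
  obtain ⟨g, hg⟩ := (Matrix.toLin' X).exists_generalized_inverse
  obtain ⟨G, rfl⟩ := Matrix.toLin'.surjective g
  rw [← Matrix.toLin'_mul, ← Matrix.toLin'_mul] at hg
  have hG : X * (G * X) = X := Matrix.toLin'.injective hg
  refine ⟨1 - G * X, by rw [Matrix.mul_sub, hG, Matrix.mul_one, sub_self], fun Z => ?_⟩
  have hZ : Z.1ᵀ = Z.1 := Z.2
  -- The factor 1/2 shares the term PᵀZP equally between XᵀY and its transpose.
  refine ⟨Gᵀ * Z.1 - (1 / 2 : ℝ) • (Gᵀ * Z.1 * G * X), ?_⟩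
  simp only [transpose_sub, transpose_mul, transpose_smul, transpose_one, transpose_transpose, hZ,
    Matrix.mul_sub, Matrix.sub_mul, Matrix.mul_smul, Matrix.smul_mul, Matrix.mul_one,
    Matrix.one_mul, Matrix.mul_assoc]
  module

/-- This is the derivative at t = 0 of the curve (x + ty)(x + ty)ᵀ in the cone; replacing y by −y
gives the opposite direction. -/
lemma symProd_mem_convexTangentSpace (x y : Fin d → ℝ) :
    symProd x y ∈ convexTangentSpace (psdCone d) (outer x) := by
  have key : ∀ y, symProd x y ∈ tangentCone (psdCone d) (outer x) := by
    intro y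
    have hlim : Filter.Tendsto (fun t : ℝ => symProd x y + t • outer y) (nhdsWithin 0 (Set.Ioi 0))
        (nhds (symProd x y)) := by
      have : Continuous fun t : ℝ => symProd x y + t • outer y := by fun_prop
      simpa using (this.tendsto 0).mono_left nhdsWithin_le_nhds
    refine mem_closure_of_tendsto hlim ?_
    filter_upwards [self_mem_nhdsWithin] with t ht
    have ht' : (0 : ℝ) < t := ht
    have : symProd x y + t • outer y = t⁻¹ • (outer (x + t • y) - outer x) := by
      apply Subtype.ext
      ext a b
      simp [symProd, outer, vecMulVec_apply]
      field_simp
      ring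
    rw [this]
    exact PointedCone.smul_mem _ (by positivity)
      (PointedCone.subset_hull ⟨_, outer_mem _, rfl⟩)
  refine ⟨key y, ?_⟩
  have : -symProd x y = symProd x (-y) := by
    apply Subtype.ext
    ext a b
    simp [symProd, vecMulVec_apply]
    ring
  change -symProd x y ∈ tangentCone (psdCone d) (outer x)
  rw [this]
  exact key _

lemma mulVec_orthogonal {X : Matrix (Fin k) (Fin d) ℝ} {R : Matrix (Fin d) (Fin d) ℝ}
    (hR : X * R = 0) (u : Fin d → ℝ) (i : Fin k) : X i ⬝ᵥ (R *ᵥ u) = 0 := by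
  have : (X *ᵥ (R *ᵥ u)) i = 0 := by simp [mulVec_mulVec, hR]
  exact this

/-- The columns of R are orthogonal to the xᵢ, so RᵀZR has zero quadratic form and only the mixed
terms XᵀY + YᵀX remain. -/
lemma lineal_semidefOn_le (x : Fin k → Fin d → ℝ) :
    (semidefOn x).lineal ≤ ⨆ i, convexTangentSpace (psdCone d) (outer (x i)) := by
  intro Z hZ
  obtain ⟨R, hR, hdec⟩ := exists_decomposition (Matrix.of x)
  obtain ⟨Y, hY⟩ := hdec Z
  have h0 : congruence R Z = 0 := eq_zero_of_form_eq_zero fun u => by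
    rw [dotProduct_congruence]
    exact mem_lineal_semidefOn.1 hZ _ (mulVec_orthogonal hR u)
  have h0' : Rᵀ * Z.1 * R = 0 := congrArg Subtype.val h0
  have : Z = ∑ i, symProd (x i) (Y i) := by
    apply Subtype.ext
    rw [hY, h0', zero_add, AddSubmonoidClass.coe_finsetSum]
    ext a b
    rw [Matrix.sum_apply]
    simp [symProd, Matrix.mul_apply, vecMulVec_apply, Finset.sum_add_distrib]
  rw [this]
  exact Submodule.sum_mem _ fun i _ =>
    Submodule.mem_iSup_of_mem i (symProd_mem_convexTangentSpace _ _)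

/-- A symmetric matrix that is semidefinite on a subspace of codimension at most `k` differs from
a semidefinite matrix by a semidefinite matrix of rank at most `k`. -/
lemma exists_sub_of_mem_semidefOn {x : Fin k → Fin d → ℝ} {Z : SymMat d}
    (hZ : Z ∈ semidefOn x) :
    ∃ U ∈ psdCone d, ∃ M : Matrix (Fin k) (Fin d) ℝ, Z = U - gram M := by
  obtain ⟨R, hR, hdec⟩ := exists_decomposition (Matrix.of x)
  obtain ⟨Y, hY⟩ := hdec Z
  have h0 : congruence R Z ∈ psdCone d := mem_psdCone_iff.2 fun u => by
    rw [dotProduct_congruence]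
    exact hZ _ (mulVec_orthogonal hR u)
  -- Polarization: XᵀY + YᵀX = ½(X+Y)ᵀ(X+Y) − ½(X−Y)ᵀ(X−Y), where X − Y has k rows.
  refine ⟨congruence R Z + (1 / 2 : ℝ) • gram (Matrix.of x + Y),
    (psdCone d).add_mem h0 (PointedCone.smul_mem _ (by norm_num) (gram_mem _)),
    (Real.sqrt (1 / 2)) • (Matrix.of x - Y), ?_⟩
  apply Subtype.ext
  have hs : Real.sqrt (1 / 2) * Real.sqrt (1 / 2) = 1 / 2 := Real.mul_self_sqrt (by norm_num)
  change Z.1 = Rᵀ * Z.1 * R + (1 / 2 : ℝ) • ((of x + Y)ᵀ * (of x + Y)) -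
    (Real.sqrt (1 / 2) • (of x - Y))ᵀ * (Real.sqrt (1 / 2) • (of x - Y))
  rw [transpose_smul, Matrix.smul_mul, Matrix.mul_smul, smul_smul, hs]
  conv_lhs => rw [hY]
  simp only [transpose_add, transpose_sub, Matrix.mul_add, Matrix.add_mul, Matrix.mul_sub,
    Matrix.sub_mul]
  module

end Semidefinite

/-! ### Dimension of the lineality space. -/

section Dimension

/-- Symmetric matrices are the functions on unordered pairs of indices. -/
lemma finrank_symMat (d : ℕ) : Module.finrank ℝ (SymMat d) = (d + 1).choose 2 := by
  let e : SymMat d ≃ₗ[ℝ] (Sym2 (Fin d) → ℝ) :=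
    { toFun := fun Z => Sym2.lift ⟨fun a b => Z.1 a b, fun a b => (Z.2.apply a b).symm⟩
      invFun := fun f => ⟨Matrix.of fun a b => f s(a, b), by
        change _ = _
        ext a b
        simp [Sym2.eq_swap]⟩
      map_add' := fun Z W => by
        ext s
        induction s with | _ a b => simp
      map_smul' := fun c Z => by
        ext s
        induction s with | _ a b => simp
      left_inv := fun Z => by
        apply Subtype.ext
        ext a b
        simp
      right_inv := fun f => by
        ext s
        induction s with | _ a b => simp }
  rw [e.finrank_eq, Module.finrank_fintype_fun_eq_card, Sym2.card, Fintype.card_fin]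

lemma exists_kernel_matrix {d k : ℕ} (X : Matrix (Fin k) (Fin d) ℝ) :
    ∃ (N : Matrix (Fin d) (Fin (d - k)) ℝ) (L : Matrix (Fin (d - k)) (Fin d) ℝ),
      X * N = 0 ∧ L * N = 1 := by
  have hdim : d - k ≤ Module.finrank ℝ (LinearMap.ker (Matrix.toLin' X)) := by
    have h1 := (Matrix.toLin' X).finrank_range_add_finrank_ker
    have h2 : Module.finrank ℝ (LinearMap.range (Matrix.toLin' X)) ≤ k := by
      simpa using (LinearMap.range (Matrix.toLin' X)).finrank_le
    simp only [Module.finrank_fintype_fun_eq_card, Fintype.card_fin] at h1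
    omega
  obtain ⟨v, hv⟩ := exists_linearIndependent_of_le_finrank hdim
  have hv' : LinearIndependent ℝ fun i => (v i : Fin d → ℝ) :=
    hv.map' (LinearMap.ker (Matrix.toLin' X)).subtype (by simp)
  let N : Matrix (Fin d) (Fin (d - k)) ℝ := (Matrix.of fun i => (v i : Fin d → ℝ))ᵀ
  have hN : LinearMap.ker (Matrix.toLin' N) = ⊥ := by
    rw [LinearMap.ker_eq_bot]
    exact Matrix.mulVec_injective_iff.2 hv'
  obtain ⟨l, hl⟩ := (Matrix.toLin' N).exists_leftInverse_of_injective hN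
  obtain ⟨L, rfl⟩ := Matrix.toLin'.surjective l
  refine ⟨N, L, ?_, ?_⟩
  · ext a j
    have := (v j).2
    rw [LinearMap.mem_ker, Matrix.toLin'_apply] at this
    exact congrFun this a
  · apply Matrix.toLin'.injective
    rw [Matrix.toLin'_mul, hl, Matrix.toLin'_one]

/-- Restricting forms to a (d−k)-dimensional space orthogonal to the xᵢ maps onto 𝕊^(d−k) and kills
the lineality space; rank–nullity gives the bound. -/
lemma finrank_lineal_semidefOn_add_le {d k : ℕ} (x : Fin k → Fin d → ℝ) :
    Module.finrank ℝ (semidefOn x).lineal + (d - k + 1).choose 2 ≤ (d + 1).choose 2 := by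
  obtain ⟨N, L, hN, hL⟩ := exists_kernel_matrix (Matrix.of x)
  have hsurj : LinearMap.range (congruence N) = ⊤ := by
    rw [LinearMap.range_eq_top]
    intro S
    refine ⟨congruence L S, Subtype.ext ?_⟩
    change Nᵀ * (Lᵀ * S.1 * L) * N = S.1
    have h1 : Nᵀ * Lᵀ = 1 := by rw [← transpose_mul, hL, transpose_one]
    calc Nᵀ * (Lᵀ * S.1 * L) * N = (Nᵀ * Lᵀ) * S.1 * (L * N) := by simp only [Matrix.mul_assoc]
      _ = S.1 := by rw [h1, hL, Matrix.one_mul, Matrix.mul_one]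
  have hle : (semidefOn x).lineal ≤ LinearMap.ker (congruence N) := by
    intro Z hZ
    refine eq_zero_of_form_eq_zero fun u => ?_
    rw [dotProduct_congruence]
    refine mem_lineal_semidefOn.1 hZ _ fun i => ?_
    have : (Matrix.of x *ᵥ (N *ᵥ u)) i = 0 := by simp [mulVec_mulVec, hN]
    exact this
  have h1 := (congruence N).finrank_range_add_finrank_ker
  rw [hsurj, finrank_top, finrank_symMat, finrank_symMat] at h1
  have h2 := Submodule.finrank_mono hle
  omega

end Dimension

/-! ### Rank-one matrices and extreme rays. -/

section RankOne

variable {d k : ℕ}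

lemma outer_zero : outer (0 : Fin d → ℝ) = 0 := by
  apply Subtype.ext
  ext a b
  simp [outer]

lemma outer_smul (c : ℝ) (x : Fin d → ℝ) : outer (c • x) = c ^ 2 • outer x := by
  apply Subtype.ext
  ext a b
  simp [outer, vecMulVec_apply]
  ring

lemma outer_eq_zero_iff {x : Fin d → ℝ} : outer x = 0 ↔ x = 0 := by
  refine ⟨fun h => ?_, fun h => h ▸ outer_zero⟩
  have := tr_outer x
  rw [h, ← trLin_apply, map_zero] at this
  exact dotProduct_self_eq_zero.1 this.symm

/-- A positive semidefinite matrix of rank at most `k` is a sum of `k` matrices `x xᵀ`. -/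
lemma exists_eq_sum_outer {X : SymMat d} (hX : X ∈ psdCone d) (hk : X.1.rank ≤ k) :
    ∃ x : Fin k → Fin d → ℝ, X = ∑ i, outer (x i) := by
  have hX' : X.1.PosSemidef := hX
  set lam := hX'.1.eigenvalues with hlam
  have hcard : Fintype.card {i // lam i ≠ 0} ≤ Fintype.card (Fin k) := by
    rw [← hX'.1.rank_eq_card_non_zero_eigs, Fintype.card_fin]
    exact hk
  obtain ⟨e⟩ := Function.Embedding.nonempty_of_card_le hcard
  let y : Fin d → Fin d → ℝ := fun i =>
    Real.sqrt (lam i) • fun a => (hX'.1.eigenvectorUnitary : Matrix (Fin d) (Fin d) ℝ) a i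
  have hsum : X = ∑ i, outer (y i) := by
    apply Subtype.ext
    rw [AddSubmonoidClass.coe_finsetSum]
    conv_lhs => rw [hX'.1.spectral_theorem, Unitary.conjStarAlgAut_apply]
    ext a b
    rw [Matrix.sum_apply, Matrix.mul_apply]
    refine Finset.sum_congr rfl fun i _ => ?_
    have hs : Real.sqrt (lam i) * Real.sqrt (lam i) = lam i :=
      Real.mul_self_sqrt (hX'.eigenvalues_nonneg i)
    simp only [mul_diagonal, outer, vecMulVec_apply, y, Pi.smul_apply, smul_eq_mul,
      Function.comp_apply, star_apply, star_trivial, RCLike.ofReal_real_eq_id, id_eq]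
    rw [← hlam, mul_mul_mul_comm, hs]
    ring
  -- At most k scaled eigenvectors are nonzero; the remaining slots are filled with 0.
  refine ⟨Function.extend e (fun i => y i) 0, ?_⟩
  rw [hsum, ← Fintype.sum_of_injective e e.injective (fun i => outer (y i))]
  · refine (Fintype.sum_of_injective Subtype.val Subtype.val_injective _ _ (fun i hi => ?_)
      fun _ => rfl).symm
    have h0 : lam i = 0 := by
      by_contra h
      exact hi ⟨⟨i, h⟩, rfl⟩
    simp only [y, h0, Real.sqrt_zero, zero_smul, outer_zero]
  · intro j hj
    rw [Function.extend_apply' _ _ _ (by simpa using hj), Pi.zero_apply, outer_zero]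
  · intro i
    rw [e.injective.extend_apply]

/-- The residual of projecting z onto x is orthogonal to x, hence to z, hence to itself. -/
lemma exists_eq_smul_of_orthogonal {x z : Fin d → ℝ}
    (h : ∀ u : Fin d → ℝ, x ⬝ᵥ u = 0 → z ⬝ᵥ u = 0) : ∃ c : ℝ, z = c • x := by
  rcases eq_or_ne x 0 with rfl | hx
  · exact ⟨0, by simpa using h z (by simp)⟩
  have hxx : x ⬝ᵥ x ≠ 0 := fun h0 => hx (dotProduct_self_eq_zero.1 h0)
  refine ⟨(x ⬝ᵥ z) / (x ⬝ᵥ x), ?_⟩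
  have h1 : x ⬝ᵥ (z - ((x ⬝ᵥ z) / (x ⬝ᵥ x)) • x) = 0 := by
    rw [dotProduct_sub, dotProduct_smul, smul_eq_mul, div_mul_cancel₀ _ hxx, sub_self]
  have h2 := h _ h1
  refine sub_eq_zero.1 (dotProduct_self_eq_zero.1 ?_)
  rw [sub_dotProduct, h2, smul_dotProduct, h1]
  simp

/-- In U = Σ zᵢzᵢᵀ every term vanishes on the complement of x, so every zᵢ is a multiple of x. -/
lemma mem_hull_outer_of_form {x : Fin d → ℝ} {U : SymMat d} (hU : U ∈ psdCone d)
    (h : ∀ u : Fin d → ℝ, x ⬝ᵥ u = 0 → u ⬝ᵥ (U.1 *ᵥ u) = 0) :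
    U ∈ PointedCone.hull ℝ {outer x} := by
  obtain ⟨z, rfl⟩ := exists_eq_sum_outer hU (rank_le_width U.1)
  refine Submodule.sum_mem _ fun i _ => ?_
  obtain ⟨c, hc⟩ := exists_eq_smul_of_orthogonal (x := x) (z := z i) fun u hu => by
    have := h u hu
    rw [form_sum_outer, Finset.sum_eq_zero_iff_of_nonneg fun _ _ => sq_nonneg _] at this
    exact pow_eq_zero_iff two_ne_zero |>.1 (this i (Finset.mem_univ i))
  rw [hc, outer_smul]
  exact mem_hull_singleton.2 ⟨c ^ 2, by positivity, rfl⟩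

lemma generatesExtremeRay_outer {x : Fin d → ℝ} (hx : x ≠ 0) :
    GeneratesExtremeRay (psdCone d) (outer x) := by
  refine ⟨fun h => hx (outer_eq_zero_iff.1 h), Submodule.span_le.2 (by simpa using outer_mem x), ?_⟩
  intro U V a hU hV ha h
  obtain ⟨c, -, hc⟩ := mem_hull_singleton.1 h
  refine mem_hull_outer_of_form hU fun u hu => ?_
  have h1 := congrArg (fun Z : SymMat d => u ⬝ᵥ (Z.1 *ᵥ u)) hc
  have h2 : u ⬝ᵥ ((c • outer x).1 *ᵥ u) = c * (x ⬝ᵥ u) ^ 2 := by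
    rw [← dotProduct_outer]
    change u ⬝ᵥ ((c • (outer x).1) *ᵥ u) = _
    rw [smul_mulVec, dotProduct_smul, smul_eq_mul]
  have h3 : u ⬝ᵥ ((a • U + V).1 *ᵥ u) = a * (u ⬝ᵥ (U.1 *ᵥ u)) + u ⬝ᵥ (V.1 *ᵥ u) := by
    change u ⬝ᵥ ((a • U.1 + V.1) *ᵥ u) = _
    rw [add_mulVec, dotProduct_add, smul_mulVec, dotProduct_smul, smul_eq_mul]
  have h4 := mem_psdCone_iff.1 hU u
  have h5 := mem_psdCone_iff.1 hV u
  simp only [h2, h3, hu] at h1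
  have h6 : 0 ≤ a * (u ⬝ᵥ (U.1 *ᵥ u)) := by positivity
  have h7 : a * (u ⬝ᵥ (U.1 *ᵥ u)) = 0 := by linarith
  exact (mul_eq_zero.1 h7).resolve_left ha.ne'

variable {F : Type*} [AddCommGroup F] [Module ℝ F]

/-- Every generator of an extreme ray of a linear image of the semidefinite cone is the image of a
rank-one matrix. -/
lemma exists_outer_of_generatesExtremeRay_map {B : SymMat d →ₗ[ℝ] F} {v : F}
    (hv : GeneratesExtremeRay ((psdCone d).map B) v) : ∃ x ≠ 0, v = B (outer x) := by
  obtain ⟨X, hX, hXv⟩ := hv.2.le (self_mem_hull v)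
  change B X = v at hXv
  obtain ⟨x, rfl⟩ := exists_eq_sum_outer hX (rank_le_width X.1)
  rw [map_sum] at hXv
  have hmem : ∀ i, B (outer (x i)) ∈ PointedCone.hull ℝ {v} :=
    hv.2.mem_of_sum_mem (fun i => ⟨_, outer_mem _, rfl⟩) (hXv ▸ self_mem_hull v)
  obtain ⟨i, -, hi⟩ := Finset.exists_ne_zero_of_sum_ne_zero (hXv ▸ hv.1)
  obtain ⟨c, hc, hcv⟩ := mem_hull_singleton.1 (hmem i)
  have hc0 : c ≠ 0 := by
    rintro rfl
    exact hi (by rw [← hcv, zero_smul])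
  have hcp : 0 < c := lt_of_le_of_ne hc hc0.symm
  -- Scaling by the square root of c⁻¹ scales the rank-one matrix by c⁻¹, which undoes c.
  refine ⟨Real.sqrt c⁻¹ • x i, ?_, ?_⟩
  · intro h0
    rcases smul_eq_zero.1 h0 with h | h
    · exact (Real.sqrt_pos.2 (inv_pos.2 hcp)).ne' h
    · rw [h, outer_zero, map_zero] at hi
      exact hi rfl
  · rw [outer_smul, Real.sq_sqrt (inv_pos.2 hcp).le, map_smul, ← hcv, smul_smul,
      inv_mul_cancel₀ hc0, one_smul]

lemma exists_outer_of_generatesExtremeRay {X : SymMat d}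
    (hX : GeneratesExtremeRay (psdCone d) X) : ∃ x ≠ 0, X = outer x :=
  exists_outer_of_generatesExtremeRay_map (B := LinearMap.id) (by rwa [PointedCone.map_id])

end RankOne

/-! ### From the kernel condition to the Terracini convexity property. -/

section TerraciniOfKernel

variable {d k N : ℕ}

lemma mem_semidefOn_of_mem_psdCone (x : Fin k → Fin d → ℝ) {X : SymMat d} (hX : X ∈ psdCone d) :
    X ∈ semidefOn x := fun u _ => mem_psdCone_iff.1 hX u

lemma sub_smul_outer_mem_semidefOn {x : Fin k → Fin d → ℝ} {X : SymMat d} (hX : X ∈ psdCone d)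
    (c : ℝ) (i : Fin k) : X - c • outer (x i) ∈ semidefOn x := by
  intro u hu
  have h1 : u ⬝ᵥ ((X - c • outer (x i)).1 *ᵥ u) =
      u ⬝ᵥ (X.1 *ᵥ u) - c * (u ⬝ᵥ ((outer (x i)).1 *ᵥ u)) := by
    change u ⬝ᵥ ((X.1 - c • (outer (x i)).1) *ᵥ u) = _
    rw [sub_mulVec, dotProduct_sub, smul_mulVec, dotProduct_smul, smul_eq_mul]
  rw [h1, dotProduct_outer, hu i]
  simpa using mem_psdCone_iff.1 hX u

/-- The convex tangent spaces of the image cone, when the kernel meets the tangent cone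
trivially. -/
lemma convexTangentSpace_map_sum_outer_le {B : SymMat d →ₗ[ℝ] (Fin N → ℝ)}
    {x : Fin k → Fin d → ℝ} (hker : ∀ W ∈ semidefOn x, B W = 0 → W = 0) :
    convexTangentSpace ((psdCone d).map B) (B (∑ i, outer (x i))) ≤
      (semidefOn x).lineal.map B :=
  convexTangentSpace_map_le (feasibleDirections_psdCone_le x) hker
    (isClosed_map_of_ker (isClosed_semidefOn x) hker)

lemma bijOn_extremeRays_of_kernel (hk : 1 ≤ k) {B : SymMat d →ₗ[ℝ] (Fin N → ℝ)}
    (hker : ∀ x : Fin k → Fin d → ℝ, ∀ W ∈ semidefOn x, B W = 0 → W = 0) :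
    Set.BijOn (PointedCone.map B) (extremeRays (psdCone d))
      (extremeRays ((psdCone d).map B)) := by
  -- The kernel condition for k copies of x lets equations on the ray of B(xxᵀ) be lifted to the PSD
  -- cone.
  have heq : ∀ (x : Fin d → ℝ) (c : ℝ), ∀ U ∈ psdCone d, B U = c • B (outer x) →
      U = c • outer x := by
    intro x c U hU h
    refine sub_eq_zero.1 (hker (fun _ => x) _
      (sub_smul_outer_mem_semidefOn (x := fun _ => x) hU c ⟨0, hk⟩) ?_)
    rw [map_sub, map_smul, h, sub_self]
  have hne : ∀ x : Fin d → ℝ, x ≠ 0 → B (outer x) ≠ 0 := by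
    intro x hx h0
    refine hx (outer_eq_zero_iff.1 ?_)
    simpa using heq x 0 (outer x) (outer_mem x) (by simpa using h0)
  refine ⟨?_, ?_, ?_⟩
  · rintro _ ⟨X, hX, rfl⟩
    obtain ⟨x, hx, rfl⟩ := exists_outer_of_generatesExtremeRay hX
    rw [map_hull_singleton]
    refine ⟨_, ⟨hne x hx, ?_, ?_⟩, rfl⟩
    · rw [← map_hull_singleton]
      exact Submodule.map_mono hX.2.le
    · rintro _ _ a ⟨U, hU, rfl⟩ ⟨V, hV, rfl⟩ ha h
      obtain ⟨c, hc, hcv⟩ := mem_hull_singleton.1 h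
      have h1 : a • U + V = c • outer x := by
        refine heq x c _ ((psdCone d).add_mem (PointedCone.smul_mem _ ha.le hU) hV) ?_
        rw [hcv, map_add, map_smul]
        rfl
      have h2 := hX.2.mem_of_smul_add_mem hU hV ha
        (h1 ▸ mem_hull_singleton.2 ⟨c, hc, rfl⟩)
      rw [← map_hull_singleton]
      exact ⟨U, h2, rfl⟩
  · rintro _ ⟨X, hX, rfl⟩ _ ⟨Y, hY, rfl⟩ h
    obtain ⟨x, hx, rfl⟩ := exists_outer_of_generatesExtremeRay hX
    obtain ⟨y, hy, rfl⟩ := exists_outer_of_generatesExtremeRay hY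
    rw [map_hull_singleton, map_hull_singleton] at h
    obtain ⟨c, hc, hcv⟩ := mem_hull_singleton.1 (h ▸ self_mem_hull (B (outer x)))
    have := heq y c _ (outer_mem x) hcv.symm
    exact hull_singleton_eq_of_mem hX.1 (mem_hull_singleton.2 ⟨c, hc, this.symm⟩)
  · rintro _ ⟨v, hv, rfl⟩
    obtain ⟨x, hx, rfl⟩ := exists_outer_of_generatesExtremeRay_map hv
    exact ⟨_, ⟨_, generatesExtremeRay_outer hx, rfl⟩, map_hull_singleton _ _⟩

/-- If the kernel of `B` contains no nonzero symmetric matrix that is semidefinite on a subspace of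
codimension at most `k`, then the image of the semidefinite cone has the Terracini convexity
property. -/
lemma terraciniProperty_of_kernel (hk : 1 ≤ k) {B : SymMat d →ₗ[ℝ] (Fin N → ℝ)}
    (hker : ∀ x : Fin k → Fin d → ℝ, ∀ W ∈ semidefOn x, B W = 0 → W = 0) :
    TerraciniProperty k B := by
  have hpsd : ∀ W ∈ psdCone d, B W = 0 → W = 0 := fun W hW =>
    hker 0 W (mem_semidefOn_of_mem_psdCone _ hW)
  have hcl : IsClosed ((psdCone d).map B : Set (Fin N → ℝ)) :=
    isClosed_map_of_ker (isClosed_psdCone d) hpsd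
  have hsal : ((psdCone d).map B : ConvexCone ℝ (Fin N → ℝ)).Salient := by
    rintro _ ⟨X, hX, rfl⟩ hne ⟨Y, hY, hYX⟩
    have hYX' : B Y = -B X := hYX
    have h0 : X + Y = 0 := hpsd _ ((psdCone d).add_mem hX hY) (by rw [map_add, hYX']; abel)
    have h1 : tr X + tr Y = 0 := by rw [← tr_add, h0, ← trLin_apply, map_zero]
    have h2 := tr_nonneg hX
    have h3 := tr_nonneg hY
    have h4 := eq_zero_of_tr_eq_zero hX (by linarith)
    exact hne (by rw [h4]; exact map_zero B)
  refine ⟨hcl, hsal, bijOn_extremeRays_of_kernel hk hker, hcl, hsal, fun v hv => ?_⟩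
  choose x hx hxv using fun i => exists_outer_of_generatesExtremeRay_map (hv i)
  obtain rfl : v = fun i => B (outer (x i)) := funext hxv
  refine le_antisymm ?_ (iSup_convexTangentSpace_le_sum fun i => ⟨_, outer_mem _, rfl⟩)
  rw [← map_sum]
  refine (convexTangentSpace_map_sum_outer_le (hker x)).trans ?_
  refine (Submodule.map_mono (lineal_semidefOn_le x)).trans ?_
  rw [Submodule.map_iSup]
  exact iSup_mono fun i =>
    map_convexTangentSpace_le _ B.continuous_of_finiteDimensional _

end TerraciniOfKernel

/-! ### From exact recovery to the kernel condition. -/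

section Trace

variable {d k n : ℕ}

lemma withTrace_castSucc (A : SymMat d →ₗ[ℝ] (Fin n → ℝ)) (X : SymMat d) (i : Fin n) :
    withTrace A X i.castSucc = A X i := by
  simp [withTrace]

lemma withTrace_last (A : SymMat d →ₗ[ℝ] (Fin n → ℝ)) (X : SymMat d) :
    withTrace A X (Fin.last n) = tr X := by
  simp [withTrace]

lemma withTrace_eq_iff {A : SymMat d →ₗ[ℝ] (Fin n → ℝ)} {X Y : SymMat d} :
    withTrace A X = withTrace A Y ↔ A X = A Y ∧ tr X = tr Y := by
  refine ⟨fun h => ⟨funext fun i => ?_, ?_⟩, fun h => funext fun i => ?_⟩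
  · rw [← withTrace_castSucc, h, withTrace_castSucc]
  · rw [← withTrace_last A, h, withTrace_last]
  · refine Fin.lastCases ?_ (fun j => ?_) i
    · rw [withTrace_last, withTrace_last, h.2]
    · rw [withTrace_castSucc, withTrace_castSucc, h.1]

lemma eq_zero_of_withTrace_eq_zero {A : SymMat d →ₗ[ℝ] (Fin n → ℝ)} {X : SymMat d}
    (hX : X ∈ psdCone d) (h : withTrace A X = 0) : X = 0 := by
  refine eq_zero_of_tr_eq_zero hX ?_
  rw [← withTrace_last A, h, Pi.zero_apply]

lemma kernel_of_exactRecovery {A : SymMat d →ₗ[ℝ] (Fin n → ℝ)} (hA : ExactRecovery k A)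
    (x : Fin k → Fin d → ℝ) (W : SymMat d) (hW : W ∈ semidefOn x) (h0 : withTrace A W = 0) :
    W = 0 := by
  obtain ⟨U, hU, M, rfl⟩ := exists_sub_of_mem_semidefOn hW
  rw [map_sub, sub_eq_zero] at h0
  obtain ⟨h1, h2⟩ := withTrace_eq_iff.1 h0
  have hrec := hA (gram M) (gram_mem M) (rank_gram_le M)
  have hM : gram M ∈ traceMinimizers A (A (gram M)) := hrec ▸ rfl
  have hU' : U ∈ traceMinimizers A (A (gram M)) :=
    ⟨hU, h1, fun Y hY hAY => h2 ▸ hM.2.2 Y hY hAY⟩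
  rw [hrec] at hU'
  rw [hU', sub_self]

end Trace

/-! ### Dimension bound from Terracini convexity, and the failure of recovery. -/

section Converse

variable {d k n N : ℕ}

/-- If the image of the semidefinite cone has extreme rays in bijection with those of the
semidefinite cone, then the kernel meets the tangent cones at rank-one matrices trivially. -/
lemma kernel_of_bijOn_extremeRays {B : SymMat d →ₗ[ℝ] (Fin N → ℝ)}
    (hpsd : ∀ W ∈ psdCone d, B W = 0 → W = 0)
    (hB : Set.BijOn (PointedCone.map B) (extremeRays (psdCone d))
      (extremeRays ((psdCone d).map B)))
    (x : Fin 1 → Fin d → ℝ) (W : SymMat d) (hW : W ∈ semidefOn x) (h0 : B W = 0) : W = 0 := by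
  obtain ⟨U, hU, M, rfl⟩ := exists_sub_of_mem_semidefOn hW
  have hM : gram M = outer (M 0) := by rw [gram_eq_sum, Fin.sum_univ_one]
  rw [hM] at h0 ⊢
  rw [map_sub, sub_eq_zero] at h0
  rcases eq_or_ne (M 0) 0 with hy | hy
  · rw [hy, outer_zero, map_zero] at h0
    rw [hy, outer_zero, hpsd U hU h0, sub_zero]
  have hyne : outer (M 0) ≠ 0 := fun h => hy (outer_eq_zero_iff.1 h)
  have hray : GeneratesExtremeRay ((psdCone d).map B) (B (outer (M 0))) := by
    rw [generatesExtremeRay_iff, ← map_hull_singleton]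
    exact hB.mapsTo ⟨_, generatesExtremeRay_outer hy, rfl⟩
  -- The image of U lies on an extreme ray, hence so do the images of its rank-one summands;
  -- injectivity on rays puts the summands on the ray of `outer (M 0)`.
  have hmem : U ∈ PointedCone.hull ℝ {outer (M 0)} := by
    obtain ⟨z, rfl⟩ := exists_eq_sum_outer hU (rank_le_width U.1)
    refine Submodule.sum_mem _ fun j _ => ?_
    rcases eq_or_ne (z j) 0 with hz | hz
    · rw [hz, outer_zero]
      exact Submodule.zero_mem _
    rw [map_sum] at h0
    have h1 : B (outer (z j)) ∈ PointedCone.hull ℝ {B (outer (M 0))} :=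
      hray.2.mem_of_sum_mem (f := fun j => B (outer (z j))) (fun i => ⟨_, outer_mem _, rfl⟩)
        (by rw [h0]; exact self_mem_hull _) j
    have h2 : B (outer (z j)) ≠ 0 := fun h =>
      hz (outer_eq_zero_iff.1 (hpsd _ (outer_mem _) h))
    have h3 := hull_singleton_eq_of_mem h2 h1
    rw [← map_hull_singleton, ← map_hull_singleton] at h3
    rw [← hB.injOn ⟨_, generatesExtremeRay_outer hz, rfl⟩ ⟨_, generatesExtremeRay_outer hy, rfl⟩ h3]
    exact self_mem_hull _
  obtain ⟨c, -, rfl⟩ := mem_hull_singleton.1 hmem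
  have h1 : (c - 1) • B (outer (M 0)) = 0 := by
    rw [sub_smul, one_smul, ← map_smul, h0, sub_self]
  have h2 : c = 1 := sub_eq_zero.1 ((smul_eq_zero.1 h1).resolve_right hray.1)
  rw [h2, one_smul, sub_self]

lemma lineal_semidefOn_mono (x : Fin k → Fin d → ℝ) (i : Fin k) :
    (semidefOn fun _ : Fin 1 => x i).lineal ≤ (semidefOn x).lineal := fun _ hZ =>
  mem_lineal_semidefOn.2 fun u hu => mem_lineal_semidefOn.1 hZ u fun _ => hu i

/-- Terracini convexity reduces the tangent space to those at single rank-one matrices, where the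
ray bijection gives the kernel condition. Each of these lies in the image of the one lineality space
of `semidefOn x`, whose dimension is known. -/
lemma finrank_convexTangentSpace_le {B : SymMat d →ₗ[ℝ] (Fin N → ℝ)}
    (hpsd : ∀ W ∈ psdCone d, B W = 0 → W = 0) (hB : TerraciniProperty k B)
    {x : Fin k → Fin d → ℝ} (hx : ∀ i, x i ≠ 0) :
    Module.finrank ℝ (convexTangentSpace ((psdCone d).map B) (B (∑ i, outer (x i)))) +
      (d - k + 1).choose 2 ≤ (d + 1).choose 2 := by
  obtain ⟨-, -, hbij, -, -, hT⟩ := hB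
  have hle : convexTangentSpace ((psdCone d).map B) (B (∑ i, outer (x i))) ≤
      (semidefOn x).lineal.map B := by
    rw [map_sum, hT (fun i => B (outer (x i))) fun i => ?_]
    · refine iSup_le fun i => ?_
      have h := convexTangentSpace_map_sum_outer_le (x := fun _ : Fin 1 => x i)
        (kernel_of_bijOn_extremeRays hpsd hbij _)
      rw [Fin.sum_univ_one] at h
      exact h.trans (Submodule.map_mono (lineal_semidefOn_mono x i))
    · rw [generatesExtremeRay_iff, ← map_hull_singleton]
      exact hbij.mapsTo ⟨_, generatesExtremeRay_outer (hx i), rfl⟩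
  have h1 := Submodule.finrank_mono hle
  have h2 := Submodule.finrank_map_le B (semidefOn x).lineal
  have h3 := finrank_lineal_semidefOn_add_le x
  omega

/-- The matrix sI is the sum of the rank-one matrices of the vectors √s·eᵢ, whose common orthogonal
complement is 0, so the lineality condition is void. -/
lemma convexTangentSpace_psdCone_eq_top {Y : SymMat d} (hY : Y ∈ psdCone d) {s : ℝ} (hs : 0 < s) :
    convexTangentSpace (psdCone d) (s • gram (1 : Matrix (Fin d) (Fin d) ℝ) + Y) = ⊤ := by
  let x : Fin d → Fin d → ℝ := fun i => Real.sqrt s • (1 : Matrix (Fin d) (Fin d) ℝ) i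
  have hx : s • gram (1 : Matrix (Fin d) (Fin d) ℝ) = ∑ i, outer (x i) := by
    rw [gram_eq_sum, Finset.smul_sum]
    exact Finset.sum_congr rfl fun i _ => by rw [outer_smul, Real.sq_sqrt hs.le]
  have htop : (semidefOn x).lineal = ⊤ := by
    refine eq_top_iff.2 fun Z _ => mem_lineal_semidefOn.2 fun u hu => ?_
    have : u = 0 := by
      funext i
      have h1 := hu i
      rw [smul_dotProduct, smul_eq_mul] at h1
      have h2 := (mul_eq_zero.1 h1).resolve_left (Real.sqrt_pos.2 hs).ne'
      have h3 : ((1 : Matrix (Fin d) (Fin d) ℝ) *ᵥ u) i = 0 := h2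
      simpa using h3
    rw [this, zero_dotProduct]
  rw [eq_top_iff, ← htop, hx]
  exact ((lineal_semidefOn_le x).trans
    (iSup_convexTangentSpace_le_sum fun i => outer_mem _)).trans (convexTangentSpace_le_add _ hY)

lemma tr_pos_of_posDef (hd : 0 < d) {P : SymMat d} (hP : P.1.PosDef) : 0 < tr P := by
  have : Nonempty (Fin d) := ⟨⟨0, hd⟩⟩
  exact hP.trace_pos

lemma surjective_withTrace (hd : 0 < d) {A : SymMat d →ₗ[ℝ] (Fin n → ℝ)}
    (hA : IsSurjectiveWithPosDefKernel A) : Function.Surjective (withTrace A) := by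
  obtain ⟨hsurj, P, hP, hAP⟩ := hA
  have hP0 := tr_pos_of_posDef hd hP
  intro v
  obtain ⟨X, hX⟩ := hsurj fun i => v i.castSucc
  refine ⟨X + ((v (Fin.last n) - tr X) / tr P) • P, funext fun i => ?_⟩
  refine Fin.lastCases ?_ (fun j => ?_) i
  · rw [withTrace_last, tr_add, tr_smul, div_mul_cancel₀ _ hP0.ne']
    ring
  · rw [withTrace_castSucc, map_add, map_smul, hAP, hX]
    simp

/-- Under the Terracini convexity property, a sum of `k` rank-one matrices and a positive definite
matrix never have the same image, if the number of measurements is large. -/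
lemma withTrace_ne_of_terraciniProperty (hd : 0 < d)
    (hn : n > (d + 1).choose 2 - (d - k + 1).choose 2) {A : SymMat d →ₗ[ℝ] (Fin n → ℝ)}
    (hA : IsSurjectiveWithPosDefKernel A) (hT : TerraciniProperty k (withTrace A))
    {x : Fin k → Fin d → ℝ} (hx : ∀ i, x i ≠ 0) {Y : SymMat d} (hY : Y ∈ psdCone d) {s : ℝ}
    (hs : 0 < s) :
    withTrace A (∑ i, outer (x i)) ≠
      withTrace A (s • gram (1 : Matrix (Fin d) (Fin d) ℝ) + Y) := by
  intro h
  have h1 := finrank_convexTangentSpace_le (B := withTrace A)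
    (fun W hW => eq_zero_of_withTrace_eq_zero hW) hT hx
  have h2 := map_convexTangentSpace_le (psdCone d)
    (withTrace A).continuous_of_finiteDimensional
    (s • gram (1 : Matrix (Fin d) (Fin d) ℝ) + Y)
  rw [convexTangentSpace_psdCone_eq_top hY hs, Submodule.map_top,
    LinearMap.range_eq_top.2 (surjective_withTrace hd hA)] at h2
  rw [h, top_le_iff.1 h2, finrank_top, Module.finrank_fintype_fun_eq_card, Fintype.card_fin] at h1
  omega

/-- If exact recovery fails, it fails with two feasible points of the same trace. -/
lemma exists_withTrace_eq_of_not_exactRecovery (hkd : k < d) {A : SymMat d →ₗ[ℝ] (Fin n → ℝ)}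
    (hA : IsSurjectiveWithPosDefKernel A) (h : ¬ ExactRecovery k A) :
    ∃ X ∈ psdCone d, X.1.rank ≤ k ∧ ∃ Y ∈ psdCone d, Y ≠ X ∧ withTrace A Y = withTrace A X := by
  obtain ⟨-, P, hP, hAP⟩ := hA
  have hP0 := tr_pos_of_posDef (by omega) hP
  rw [ExactRecovery] at h
  push Not at h
  obtain ⟨X, hX, hrank, hne⟩ := h
  obtain ⟨Y, hY, hYX, hAY, htr⟩ :
      ∃ Y ∈ psdCone d, Y ≠ X ∧ A Y = A X ∧ tr Y ≤ tr X := by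
    by_contra! hcon
    refine hne (Set.eq_singleton_iff_unique_mem.2 ⟨⟨hX, rfl, fun Y hY hAY => ?_⟩, ?_⟩)
    · rcases eq_or_ne Y X with rfl | hYX
      · exact le_rfl
      · exact (hcon Y hY hYX hAY).le
    · rintro Y ⟨hY, hAY, hmin⟩
      by_contra hYX
      exact absurd (hmin X hX rfl) (not_le.2 (hcon Y hY hYX hAY))
  -- Adding a multiple of the kernel matrix P raises the trace of Y to that of X without changing
  -- A(Y). Were the sum equal to X with a positive multiple, X would have rank d > k.
  refine ⟨X, hX, hrank, Y + ((tr X - tr Y) / tr P) • P, ?_, ?_, ?_⟩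
  · exact (psdCone d).add_mem hY
      (PointedCone.smul_mem _ (div_nonneg (sub_nonneg.2 htr) hP0.le) hP.posSemidef)
  · intro heq
    rcases htr.eq_or_lt with h0 | h0
    · rw [h0, sub_self, zero_div, zero_smul, add_zero] at heq
      exact hYX heq
    · have hpos : 0 < (tr X - tr Y) / tr P := div_pos (sub_pos.2 h0) hP0
      have hdef : X.1.PosDef := by
        rw [← heq]
        exact Matrix.PosDef.posSemidef_add hY (hP.smul hpos)
      have := rank_of_isUnit X.1 hdef.isUnit
      rw [Fintype.card_fin] at this
      omega
  · refine withTrace_eq_iff.2 ⟨by rw [map_add, map_smul, hAP, hAY, smul_zero, add_zero], ?_⟩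
    rw [tr_add, tr_smul, div_mul_cancel₀ _ hP0.ne']
    ring

end Converse

/-! ### Perturbing the measurement map. -/

section Perturbation

variable {d k n : ℕ}

lemma continuous_outer : Continuous (outer : (Fin d → ℝ) → SymMat d) :=
  (continuous_id.matrix_vecMulVec continuous_id).subtype_mk _

lemma continuous_tr : Continuous (tr : SymMat d → ℝ) :=
  (trLin d).continuous_of_finiteDimensional

lemma tr_gram_one_pos (hd : 0 < d) : 0 < tr (gram (1 : Matrix (Fin d) (Fin d) ℝ)) := by
  simpa [tr, gram] using hd

/-- A sum of `k` rank-one matrices is a limit of sums of `k` nonzero rank-one matrices of larger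
trace. -/
lemma exists_perturbation_sum_outer (hd : 0 < d) {x : Fin k → Fin d → ℝ}
    (h0 : ∑ i, outer (x i) ≠ 0) :
    ∃ ξ : ℝ → Fin k → Fin d → ℝ, Continuous ξ ∧ ξ 0 = x ∧ ∀ ε > 0,
      (∀ i, ξ ε i ≠ 0) ∧ tr (∑ i, outer (x i)) < tr (∑ i, outer (ξ ε i)) := by
  classical
  -- Only the zero vectors are moved, towards the all-ones vector; the factor √(1 + |ε|) below makes
  -- the trace increase strictly.
  let w : Fin k → Fin d → ℝ := fun i => if x i = 0 then fun _ => 1 else 0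
  have hcase : ∀ (ε : ℝ) i, 0 < ε → x i + ε • w i ≠ 0 ∧
      x i ⬝ᵥ x i ≤ (x i + ε • w i) ⬝ᵥ (x i + ε • w i) := by
    intro ε i hε
    by_cases hi : x i = 0
    · refine ⟨fun h => ?_, ?_⟩
      · have := congrFun h ⟨0, hd⟩
        simp [w, hi, hε.ne'] at this
      · rw [hi, zero_dotProduct]
        exact Finset.sum_nonneg fun _ _ => mul_self_nonneg _
    · simp [w, hi]
  refine ⟨fun ε i => Real.sqrt (1 + |ε|) • (x i + ε • w i), ?_, ?_, fun ε hε => ⟨fun i => ?_, ?_⟩⟩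
  · fun_prop
  · simp
  · exact smul_ne_zero (Real.sqrt_pos.2 (by positivity)).ne' (hcase ε i hε).1
  · have hpos : 0 < tr (∑ i, outer (x i)) := by
      have hmem : ∑ i, outer (x i) ∈ psdCone d := (psdCone d).sum_mem fun i _ => outer_mem _
      exact lt_of_le_of_ne (tr_nonneg hmem) fun h => h0 (eq_zero_of_tr_eq_zero hmem h.symm)
    have htr : ∀ y : Fin k → Fin d → ℝ, tr (∑ i, outer (y i)) = ∑ i, y i ⬝ᵥ y i := by
      intro y
      rw [← trLin_apply, map_sum]
      exact Finset.sum_congr rfl fun i _ => tr_outer _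
    have hscale : ∑ i, outer (Real.sqrt (1 + |ε|) • (x i + ε • w i)) =
        (1 + |ε|) • ∑ i, outer (x i + ε • w i) := by
      rw [Finset.smul_sum]
      exact Finset.sum_congr rfl fun i _ => by rw [outer_smul, Real.sq_sqrt (by positivity)]
    have hle : tr (∑ i, outer (x i)) ≤ tr (∑ i, outer (x i + ε • w i)) := by
      rw [htr, htr]
      exact Finset.sum_le_sum fun i _ => (hcase ε i hε).2
    rw [hscale, tr_smul, abs_of_pos hε]
    nlinarith

lemma exists_dual_ne_zero {W : SymMat d} (hW : W ≠ 0) : ∃ l : SymMat d →ₗ[ℝ] ℝ, l W ≠ 0 := by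
  by_contra! h
  exact hW ((Module.forall_dual_apply_eq_zero_iff ℝ W).1 h)

lemma isOpen_setOf_sub_smulRight_mem {E F : Type*} [AddCommGroup E] [Module ℝ E]
    [TopologicalSpace E] [IsTopologicalAddGroup E] [ContinuousSMul ℝ E] [T2Space E]
    [FiniteDimensional ℝ E] [NormedAddCommGroup F] [NormedSpace ℝ F] [FiniteDimensional ℝ F]
    {S : Set (E →ₗ[ℝ] F)}
    (hS : IsOpen ((LinearMap.toContinuousLinearMap : (E →ₗ[ℝ] F) ≃ₗ[ℝ] (E →L[ℝ] F)) '' S))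
    (A : E →ₗ[ℝ] F) (l : E →ₗ[ℝ] ℝ) : IsOpen {c : F | A - l.smulRight c ∈ S} := by
  let Φ : F →ₗ[ℝ] (E →L[ℝ] F) :=
    (LinearMap.toContinuousLinearMap : (E →ₗ[ℝ] F) ≃ₗ[ℝ] (E →L[ℝ] F)).toLinearMap ∘ₗ
      LinearMap.smulRightₗ l
  have hΦ : Continuous Φ := Φ.continuous_of_finiteDimensional
  have hcont : Continuous fun c => LinearMap.toContinuousLinearMap A - Φ c :=
    continuous_const.sub hΦ
  convert hS.preimage hcont using 1
  ext c
  have : LinearMap.toContinuousLinearMap A - Φ c =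
      LinearMap.toContinuousLinearMap (A - l.smulRight c) := by
    rw [map_sub]
    rfl
  rw [Set.mem_preimage, this, LinearMap.toContinuousLinearMap.injective.mem_set_image]
  rfl

/-- If two points of the semidefinite cone, the first of them of low rank, have the same image and
the same trace, then arbitrarily small perturbations of `A` identify a low-rank matrix with a
positive definite one. -/
lemma exists_perturbation {S : Set (SymMat d →ₗ[ℝ] (Fin n → ℝ))} (hS : IsOpenSetOfMaps S)
    (hd : 0 < d) {A : SymMat d →ₗ[ℝ] (Fin n → ℝ)} (hA : A ∈ S) {X Y : SymMat d}
    (hX : X ∈ psdCone d) (hrank : X.1.rank ≤ k) (hY : Y ∈ psdCone d) (hYX : Y ≠ X)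
    (h : withTrace A Y = withTrace A X) :
    ∃ A' ∈ S, ∃ x : Fin k → Fin d → ℝ, (∀ i, x i ≠ 0) ∧ ∃ s : ℝ, 0 < s ∧
      withTrace A' (∑ i, outer (x i)) =
        withTrace A' (s • gram (1 : Matrix (Fin d) (Fin d) ℝ) + Y) := by
  obtain ⟨hAYX, htr⟩ := withTrace_eq_iff.1 h
  obtain ⟨x, rfl⟩ := exists_eq_sum_outer hX hrank
  have hX0 : ∑ i, outer (x i) ≠ 0 := by
    intro h0
    rw [h0] at htr hYX
    exact hYX (eq_zero_of_tr_eq_zero hY (by rw [htr, ← trLin_apply, map_zero]))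
  obtain ⟨ξ, hξ, hξ0, hξpos⟩ := exists_perturbation_sum_outer hd hX0
  have hI := tr_gram_one_pos hd
  set I : SymMat d := gram (1 : Matrix (Fin d) (Fin d) ℝ) with hIdef
  -- Chosen so that W(ε) has trace 0, given tr Y = tr X.
  let s : ℝ → ℝ := fun ε => (tr (∑ i, outer (ξ ε i)) - tr (∑ i, outer (x i))) / tr I
  let W : ℝ → SymMat d := fun ε => s ε • I + Y - ∑ i, outer (ξ ε i)
  have hsum : Continuous fun ε => ∑ i, outer (ξ ε i) :=
    continuous_finsetSum _ fun i _ => continuous_outer.comp ((continuous_apply i).comp hξ)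
  have hs : Continuous s := ((continuous_tr.comp hsum).sub continuous_const).div_const _
  have hW : Continuous W := ((hs.smul continuous_const).add continuous_const).sub hsum
  have hW0 : W 0 = Y - ∑ i, outer (x i) := by simp [W, s, hξ0]
  -- The perturbed map Z ↦ A(Z) − l(Z)·A(W(ε))/l(W(ε)) annihilates W(ε), and tends to A as ε → 0
  -- because A(W(0)) = 0.
  obtain ⟨l, hl⟩ := exists_dual_ne_zero (sub_ne_zero.2 hYX)
  rw [← hW0] at hl
  have hlW : Continuous fun ε => l (W ε) := l.continuous_of_finiteDimensional.comp hW
  have hAW : Continuous fun ε => A (W ε) := A.continuous_of_finiteDimensional.comp hW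
  have hc : ContinuousAt (fun ε => (l (W ε))⁻¹ • A (W ε)) 0 :=
    (hlW.continuousAt.inv₀ hl).smul hAW.continuousAt
  have hc0 : (l (W 0))⁻¹ • A (W 0) = 0 := by rw [hW0, map_sub, map_sub, hAYX, sub_self, smul_zero]
  have hev1 : ∀ᶠ ε in nhds (0 : ℝ), A - l.smulRight ((l (W ε))⁻¹ • A (W ε)) ∈ S := by
    refine hc.eventually_mem ((isOpen_setOf_sub_smulRight_mem hS A l).mem_nhds ?_)
    rw [hc0]
    simpa using hA
  have hev2 : ∀ᶠ ε in nhds (0 : ℝ), l (W ε) ≠ 0 := hlW.continuousAt.eventually_ne hl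
  obtain ⟨ε, ⟨h1, h2⟩, hε⟩ := ((hev1.and hev2).filter_mono
    (nhdsWithin_le_nhds (s := Set.Ioi 0))).and self_mem_nhdsWithin |>.exists
  obtain ⟨hne, hlt⟩ := hξpos ε hε
  refine ⟨_, h1, ξ ε, hne, s ε, div_pos (sub_pos.2 hlt) hI, ?_⟩
  refine withTrace_eq_iff.2 ⟨?_, ?_⟩
  · refine (sub_eq_zero.1 ?_).symm
    rw [← map_sub]
    change A (W ε) - l (W ε) • ((l (W ε))⁻¹ • A (W ε)) = 0
    rw [smul_smul, mul_inv_cancel₀ h2, one_smul, sub_self]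
  · rw [tr_add, tr_smul, htr, div_mul_cancel₀ _ hI.ne']
    ring

end Perturbation

end TerraciniPSD

theorem theorem4p5 (d n k : ℕ) (hk : 1 ≤ k) (hkd : k < d)
    (A : TerraciniPSD.SymMat d →ₗ[ℝ] (Fin n → ℝ)) :
    (TerraciniPSD.IsSurjectiveWithPosDefKernel A → TerraciniPSD.ExactRecovery k A →
      TerraciniPSD.TerraciniProperty k (TerraciniPSD.withTrace A)) ∧
    (n > (d + 1).choose 2 - (d - k + 1).choose 2 →
      (∃ S : Set (TerraciniPSD.SymMat d →ₗ[ℝ] (Fin n → ℝ)),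
        TerraciniPSD.IsOpenSetOfMaps S ∧ A ∈ S ∧
        ∀ A' ∈ S, TerraciniPSD.IsSurjectiveWithPosDefKernel A' ∧
          TerraciniPSD.TerraciniProperty k (TerraciniPSD.withTrace A')) →
      TerraciniPSD.ExactRecovery k A) := by
  refine ⟨fun _ hA => TerraciniPSD.terraciniProperty_of_kernel hk
    (TerraciniPSD.kernel_of_exactRecovery hA), ?_⟩
  rintro hn ⟨S, hS, hAS, hprop⟩
  by_contra hA
  obtain ⟨X, hX, hrank, Y, hY, hYX, heq⟩ :=
    TerraciniPSD.exists_withTrace_eq_of_not_exactRecovery hkd (hprop A hAS).1 hA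
  obtain ⟨A', hA', x, hx, s, hs, h⟩ :=
    TerraciniPSD.exists_perturbation hS (by omega) hAS hX hrank hY hYX heq
  exact TerraciniPSD.withTrace_ne_of_terraciniProperty (by omega) hn (hprop A' hA').1
    (hprop A' hA').2 hx hY hs h
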